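/- Let three candidates $C_1,C_2,C_3$ be given and let $p=(p_r)$ be an arbitrary probability distribution on the $6$ strict rankings $r$ of the candidates. Let voters $1,2,3,\dots$ choose rankings independently, each of them the ranking $r$ with probability $p_r$. Among the first $n$ voters, $C_i$ is the Condorcet winner if for each $j\ne i$ strictly more voters prefer $C_i$ to $C_j$ than prefer $C_j$ to $C_i$. For $i\neq j$ let $a_{r,(i,j)}=1$ if the ranking $r$ prefers $C_i$ to $C_j$ and $a_{r,(i,j)}=-1$ otherwise, and put $\lambda_{ij}=\sum_r a_{r,(i,j)}\,p_r$. For distinct $i,j,l$ let $a_{r,(i,j),l}=1$ if in $r$ the candidate $C_i$ is preferred to both $C_j$ and $C_l$, or both $C_j$ and $C_l$ are preferred to $C_i$, let $a_{r,(i,j),l}=-1$ otherwise, and put $$R^{i}_{jl}=\frac{\sum_r a_{r,(i,j),l}\,p_r-\lambda_{ij}\lambda_{il}}{\sqrt{(1-\lambda_{ij}^2)(1-\lambda_{il}^2)}}$$ (this is used below only when $\lambda_{ij}=\lambda_{il}=0$, so that the denominator is $1$). Write $A(x)=\frac14+\frac1{2\pi}\arcsin x$. Then, as $n\to\infty$ (through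 all $n$, odd and even), the probability that one of $C_1,C_2,C_3$ is the Condorcet winner among the first $n$ voters converges, and its limit is determined as follows by the signs of $(\lambda_{12},\lambda_{13},\lambda_{23})$: - $(0,0,0)$: $A(R^1_{23})+A(R^2_{13})+A(R^3_{12})$; - $(0,0,+)$ and $(0,0,-)$: $\frac12+A(R^1_{23})$; - $(0,+,0)$ and $(0,-,0)$: $\frac12+A(R^2_{13})$; - $(+,0,0)$ and $(-,0,0)$: $\frac12+A(R^3_{12})$; - $(0,+,-)$, $(0,-,+)$, $(+,0,+)$, $(-,0,-)$, $(+,-,0)$, $(-,+,0)$: $\frac12$; - $(+,-,+)$ and $(-,+,-)$: $0$; - the remaining $12$ sign patterns, namely $(0,+,+)$, $(0,-,-)$, $(+,0,-)$, $(-,0,+)$, $(+,+,0)$, $(-,-,0)$, $(+,+,+)$, $(+,+,-)$, $(+,-,-)$, $(-,+,+)$, $(-,-,+)$, $(-,-,-)$: $1$. -/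

import Mathlib

open MeasureTheory ProbabilityTheory Filter Topology

noncomputable section

namespace Condorcet

/-- A strict preference ranking of `m` candidates, encoded by the position it gives to each
candidate (position `0` is the most preferred one). -/
def Ranking (m : ℕ) : Type := Equiv.Perm (Fin m)

instance (m : ℕ) : Fintype (Ranking m) := inferInstanceAs (Fintype (Equiv.Perm (Fin m)))

instance (m : ℕ) : MeasurableSpace (Ranking m) := ⊤

/-- The position of each candidate in the ranking. -/
def Ranking.position {m : ℕ} (r : Ranking m) : Equiv.Perm (Fin m) := r

/-- In the ranking `r`, candidate `i` is preferred to candidate `j`. -/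
def Ranking.Prefers {m : ℕ} (r : Ranking m) (i j : Fin m) : Prop :=
  r.position i < r.position j

open Classical in
/-- The coefficient `a_{r,(i,j)}`: it is `1` if `i` is preferred to `j` in `r`, and `-1` if not. -/
def a {m : ℕ} (r : Ranking m) (i j : Fin m) : ℤ :=
  if r.Prefers i j then 1 else -1

open Classical in
/-- The coefficient `a_{r,(i,j),l}`: it is `1` if, in `r`, candidate `i` is preferred to both of
`j`, `l` or both of `j`, `l` are preferred to `i`, and `-1` otherwise. -/
def a₂ {m : ℕ} (r : Ranking m) (i j l : Fin m) : ℤ :=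
  if (r.Prefers i j ∧ r.Prefers i l) ∨ (r.Prefers j i ∧ r.Prefers l i) then 1 else -1

/-- `λ_{ij} = ∑ r, a_{r,(i,j)} p_r` -/
def lam {m : ℕ} (p : Ranking m → ℝ) (i j : Fin m) : ℝ :=
  ∑ r, (a r i j : ℝ) * p r

/-- The correlation coefficient `R^{(i)}_{jl}`. -/
def R {m : ℕ} (p : Ranking m → ℝ) (i j l : Fin m) : ℝ :=
  ((∑ r, (a₂ r i j l : ℝ) * p r) - lam p i j * lam p i l) /
    √((1 - lam p i j ^ 2) * (1 - lam p i l ^ 2))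

/-- Candidate `i` beats candidate `j` by majority rule among the first `n` voters, where voter `v`
has the ranking `V v`: strictly more of them prefer `i` to `j` than prefer `j` to `i`. -/
def Beats {m : ℕ} (V : ℕ → Ranking m) (n : ℕ) (i j : Fin m) : Prop :=
  1 ≤ ∑ v ∈ Finset.range n, a (V v) i j

/-- Candidate `i` is the Condorcet winner among the first `n` voters. -/
def IsWinner {m : ℕ} (V : ℕ → Ranking m) (n : ℕ) (i : Fin m) : Prop :=
  ∀ j, j ≠ i → Beats V n i j

/-- The entry of the table for three candidates in the row with signs `s₁₂`, `s₁₃`, `s₂₃`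
of `λ₁₂`, `λ₁₃`, `λ₂₃`, where `R₁`, `R₂`, `R₃` stand for the correlations
`R^{(1)}_{23}`, `R^{(2)}_{13}`, `R^{(3)}_{12}`. -/
def table (s₁₂ s₁₃ s₂₃ : SignType) (R₁ R₂ R₃ : ℝ) : ℝ :=
  match s₁₂, s₁₃, s₂₃ with
  | .zero, .zero, .zero =>
      (1 / 4 + 1 / (2 * Real.pi) * Real.arcsin R₁) +
      (1 / 4 + 1 / (2 * Real.pi) * Real.arcsin R₂) +
      (1 / 4 + 1 / (2 * Real.pi) * Real.arcsin R₃)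
  | .zero, .zero, .pos => 1 / 2 + 1 / 4 + 1 / (2 * Real.pi) * Real.arcsin R₁
  | .zero, .zero, .neg => 1 / 2 + 1 / 4 + 1 / (2 * Real.pi) * Real.arcsin R₁
  | .zero, .pos, .zero => 1 / 2 + 1 / 4 + 1 / (2 * Real.pi) * Real.arcsin R₂
  | .zero, .neg, .zero => 1 / 2 + 1 / 4 + 1 / (2 * Real.pi) * Real.arcsin R₂
  | .zero, .pos, .neg => 1 / 2
  | .zero, .pos, .pos => 1
  | .zero, .neg, .pos => 1 / 2
  | .zero, .neg, .neg => 1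
  | .pos, .zero, .pos => 1 / 2
  | .pos, .pos, .zero => 1
  | .pos, .zero, .neg => 1
  | .pos, .neg, .zero => 1 / 2
  | .pos, .pos, .pos => 1
  | .pos, .neg, .neg => 1
  | .pos, .pos, .neg => 1
  | .pos, .neg, .pos => 0
  | .pos, .zero, .zero => 1 / 2 + 1 / 4 + 1 / (2 * Real.pi) * Real.arcsin R₃
  | .neg, .zero, .zero => 1 / 2 + 1 / 4 + 1 / (2 * Real.pi) * Real.arcsin R₃
  | .neg, .zero, .pos => 1
  | .neg, .zero, .neg => 1 / 2
  | .neg, .pos, .zero => 1 / 2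
  | .neg, .pos, .pos => 1
  | .neg, .pos, .neg => 0
  | .neg, .neg, .zero => 1
  | .neg, .neg, .pos => 1
  | .neg, .neg, .neg => 1

end Condorcet

end

namespace Condorcet

/-! Two Condorcet winners cannot coexist, so the probability is a sum over `i` of the probability
that `i` beats both rivals. The two margins of `i` are random walks with steps `±1` and drifts `lam
p i j`, `lam p i l`. By the strong law a nonzero drift almost surely decides its comparison for all
large `n` (`ae_eventually_beats`, `ae_eventually_not_beats`): that comparison either drops out or
rules the event out. If both drifts vanish, the steps have variance 1 and covariance `R p i j l`;
the central limit theorem leads to a Gaussian quadrant, of mass `1/4 + arcsin R / (2π)`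
(`stdGaussianPlane_real_quadrant`). Its boundary is null, so ties, and hence the parity of `n`, do
not matter. Adding the three values `winLimit` gives the table. -/

/-! ### Gaussian quadrant probability -/

/-- Two half-planes whose normals make the angle `φ` meet in a wedge of opening `π - φ`. -/
lemma cos_pos_and_cos_sub_pos_iff {φ θ : ℝ} (hφ : φ ∈ Set.Icc 0 Real.pi)
    (hθ : θ ∈ Set.Ioo (-Real.pi) Real.pi) :
    (0 < Real.cos θ ∧ 0 < Real.cos (θ - φ)) ↔
      θ ∈ Set.Ioo (φ - Real.pi / 2) (Real.pi / 2) := by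
  obtain ⟨h0, h1⟩ := hφ
  obtain ⟨h2, h3⟩ := hθ
  constructor
  · rintro ⟨ha, hb⟩
    have hlt : θ < Real.pi / 2 := by
      by_contra! h
      exact ha.not_ge (Real.cos_nonpos_of_pi_div_two_le_of_le h (by linarith))
    refine ⟨?_, hlt⟩
    by_contra! h
    have hgt : -(Real.pi / 2) < θ := by
      by_contra! h'
      rw [← Real.cos_neg] at ha
      exact ha.not_ge (Real.cos_nonpos_of_pi_div_two_le_of_le (by linarith) (by linarith))
    rw [← Real.cos_neg] at hb
    exact hb.not_ge (Real.cos_nonpos_of_pi_div_two_le_of_le (by linarith) (by linarith))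
  · rintro ⟨ha, hb⟩
    exact ⟨Real.cos_pos_of_mem_Ioo ⟨by linarith, hb⟩,
      Real.cos_pos_of_mem_Ioo ⟨by linarith, by linarith⟩⟩

/-- The standard Gaussian measure on the plane. -/
noncomputable abbrev stdGaussianPlane : Measure (ℝ × ℝ) := (gaussianReal 0 1).prod (gaussianReal 0 1)

lemma stdGaussianPlane_real_apply {S : Set (ℝ × ℝ)} (hS : MeasurableSet S) :
    stdGaussianPlane.real S =
      ∫ z : ℝ × ℝ, S.indicator
        (fun z => (2 * Real.pi)⁻¹ * Real.exp (-(z.1 ^ 2 + z.2 ^ 2) / 2)) z := by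
  rw [stdGaussianPlane, gaussianReal_of_var_ne_zero 0 one_ne_zero,
    prod_withDensity (by fun_prop) (by fun_prop), measureReal_def, withDensity_apply _ hS,
    integral_indicator hS, ← Measure.volume_eq_prod,
    integral_eq_lintegral_of_nonneg_ae (ae_of_all _ fun _ => by positivity)
      (by fun_prop)]
  congr 1
  refine lintegral_congr fun z => ?_
  rw [gaussianPDF, gaussianPDF, ← ENNReal.ofReal_mul (gaussianPDFReal_nonneg _ _ _)]
  congr 1
  simp only [gaussianPDFReal, NNReal.coe_one, mul_one, sub_zero]
  rw [mul_mul_mul_comm, ← Real.exp_add, ← mul_inv, Real.mul_self_sqrt (by positivity)]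
  congr 2
  ring

lemma integral_mul_exp_neg_sq_div_two :
    ∫ r in Set.Ioi (0 : ℝ), r * Real.exp (-r ^ 2 / 2) = 1 := by
  have := integral_rpow_mul_exp_neg_mul_rpow (p := 2) (q := 1) (b := 1 / 2) (by norm_num)
    (by norm_num) (by norm_num)
  norm_num at this
  rw [← this]
  refine setIntegral_congr_fun measurableSet_Ioi fun r _ => ?_
  congr 2
  ring

/-- The probability that two standard Gaussian variables with correlation `ρ` are both
positive. -/
theorem stdGaussianPlane_real_quadrant {ρ : ℝ} (hρ : ρ ∈ Set.Icc (-1) 1) :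
    stdGaussianPlane.real {z | 0 < z.1 ∧ 0 < ρ * z.1 + √(1 - ρ ^ 2) * z.2} =
      1 / 4 + 1 / (2 * Real.pi) * Real.arcsin ρ := by
  have hmeas : MeasurableSet {z : ℝ × ℝ | 0 < z.1 ∧ 0 < ρ * z.1 + √(1 - ρ ^ 2) * z.2} :=
    (measurableSet_lt measurable_const measurable_fst).inter
      (measurableSet_lt (g := fun z : ℝ × ℝ => ρ * z.1 + √(1 - ρ ^ 2) * z.2) measurable_const
        (by fun_prop))
  rw [stdGaussianPlane_real_apply hmeas, ← integral_comp_polarCoord_symm, polarCoord_target]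
  -- In polar coordinates the second linear form is `r * cos (θ - φ)`, so the integrand splits into
  -- a radial factor and the indicator of a wedge.
  set φ := Real.arccos ρ with hφdef
  have hcos : Real.cos φ = ρ := Real.cos_arccos hρ.1 hρ.2
  have hsin : Real.sin φ = √(1 - ρ ^ 2) := Real.sin_arccos ρ
  have hφ : φ ∈ Set.Icc 0 Real.pi := ⟨Real.arccos_nonneg _, Real.arccos_le_pi _⟩
  have hcongr : ∀ q ∈ Set.Ioi (0 : ℝ) ×ˢ Set.Ioo (-Real.pi) Real.pi,
      q.1 • ({z : ℝ × ℝ | 0 < z.1 ∧ 0 < ρ * z.1 + √(1 - ρ ^ 2) * z.2}.indicator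
        (fun z => (2 * Real.pi)⁻¹ * Real.exp (-(z.1 ^ 2 + z.2 ^ 2) / 2)) (polarCoord.symm q)) =
      (q.1 * Real.exp (-q.1 ^ 2 / 2)) *
        (Set.Ioo (φ - Real.pi / 2) (Real.pi / 2)).indicator (fun _ => (2 * Real.pi)⁻¹) q.2 := by
    rintro ⟨r, θ⟩ ⟨hr, hθ⟩
    have hr : 0 < r := hr
    have hiff : polarCoord.symm (r, θ) ∈
        {z : ℝ × ℝ | 0 < z.1 ∧ 0 < ρ * z.1 + √(1 - ρ ^ 2) * z.2} ↔
        θ ∈ Set.Ioo (φ - Real.pi / 2) (Real.pi / 2) := by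
      rw [← cos_pos_and_cos_sub_pos_iff hφ hθ, polarCoord_symm_apply, Set.mem_ofPred_eq,
        ← hcos, hcos, ← hsin, ← hcos, Real.cos_sub]
      have : Real.cos φ * (r * Real.cos θ) + Real.sin φ * (r * Real.sin θ) =
        r * (Real.cos θ * Real.cos φ + Real.sin θ * Real.sin φ) := by ring
      simp only [this, mul_pos_iff_of_pos_left hr]
    by_cases h : θ ∈ Set.Ioo (φ - Real.pi / 2) (Real.pi / 2)
    · rw [Set.indicator_of_mem (hiff.2 h), Set.indicator_of_mem h, polarCoord_symm_apply]
      have : (r * Real.cos θ) ^ 2 + (r * Real.sin θ) ^ 2 = r ^ 2 := by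
        linear_combination r ^ 2 * Real.sin_sq_add_cos_sq θ
      simp only [this, smul_eq_mul]
      ring
    · rw [Set.indicator_of_notMem (fun h' => h (hiff.1 h')), Set.indicator_of_notMem h]
      simp
  rw [setIntegral_congr_fun (measurableSet_Ioi.prod measurableSet_Ioo) hcongr,
    Measure.volume_eq_prod,
    setIntegral_prod_mul (fun r => r * Real.exp (-r ^ 2 / 2))
      ((Set.Ioo (φ - Real.pi / 2) (Real.pi / 2)).indicator fun _ => (2 * Real.pi)⁻¹),
    integral_mul_exp_neg_sq_div_two, one_mul,
    setIntegral_indicator measurableSet_Ioo, Set.inter_eq_self_of_subset_right, setIntegral_const]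
  -- The opening is `π - arccos ρ = π / 2 + arcsin ρ`, weighted by `1 / (2π)`.
  · have hle : 0 ≤ Real.pi / 2 - (φ - Real.pi / 2) := by linarith [hφ.2]
    rw [measureReal_def, Real.volume_Ioo, ENNReal.toReal_ofReal hle, hφdef, Real.arccos,
      smul_eq_mul]
    field_simp
    ring
  · exact Set.Ioo_subset_Ioo (by linarith [hφ.1, Real.pi_pos]) (by linarith [Real.pi_pos])

lemma stdGaussianPlane_fst_eq_zero : stdGaussianPlane {z | z.1 = 0} = 0 := by
  have : NullSingletonClass (gaussianReal 0 1) := nullSingletonClass_gaussianReal one_ne_zero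
  have h : {z : ℝ × ℝ | z.1 = 0} = {0} ×ˢ Set.univ := by ext; simp
  rw [h, Measure.prod_prod]
  simp

/-- The case `s = 0` is needed for `ρ = ±1`, where the second coefficient vanishes. Otherwise each
vertical slice is one point. -/
lemma stdGaussianPlane_linear_eq_zero {r s : ℝ} (h : r ≠ 0 ∨ s ≠ 0) :
    stdGaussianPlane {z | r * z.1 + s * z.2 = 0} = 0 := by
  have : NullSingletonClass (gaussianReal 0 1) := nullSingletonClass_gaussianReal one_ne_zero
  by_cases hs : s = 0
  · have hr : r ≠ 0 := by simpa [hs] using h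
    simpa [hs, hr] using stdGaussianPlane_fst_eq_zero
  · rw [Measure.measure_prod_null (measurableSet_eq_fun (by fun_prop) (by fun_prop))]
    refine ae_of_all _ fun u => ?_
    refine measure_mono_null (t := {-(r * u) / s}) (fun v hv => ?_) (measure_singleton _)
    have hv : r * u + s * v = 0 := hv
    rw [Set.mem_singleton_iff, eq_div_iff hs]
    linarith

/-! ### Bivariate central limit theorem -/

/-- Two standard Gaussian variables with correlation `ρ`, as the coordinates of a complex number. -/
noncomputable def correlatedPair (ρ : ℝ) (z : ℝ × ℝ) : ℂ :=
  (z.1 : ℂ) + (ρ * z.1 + √(1 - ρ ^ 2) * z.2 : ℝ) * Complex.I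

@[simp] lemma correlatedPair_re (ρ : ℝ) (z : ℝ × ℝ) : (correlatedPair ρ z).re = z.1 := by
  simp [correlatedPair]

@[simp] lemma correlatedPair_im (ρ : ℝ) (z : ℝ × ℝ) :
    (correlatedPair ρ z).im = ρ * z.1 + √(1 - ρ ^ 2) * z.2 := by
  simp [correlatedPair]

@[fun_prop] lemma measurable_correlatedPair (ρ : ℝ) : Measurable (correlatedPair ρ) := by
  unfold correlatedPair
  fun_prop

/-- The exponent is the quadratic form of the covariance matrix. `ℂ` serves as the Euclidean plane,
since `charFun` uses an inner product. -/
lemma charFun_map_correlatedPair {ρ : ℝ} (hρ : ρ ∈ Set.Icc (-1) 1) (t : ℂ) :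
    charFun (stdGaussianPlane.map (correlatedPair ρ)) t =
      Complex.exp (-((t.re ^ 2 + 2 * ρ * t.re * t.im + t.im ^ 2 : ℝ) : ℂ) / 2) := by
  have hsq : √(1 - ρ ^ 2) ^ 2 = 1 - ρ ^ 2 := Real.sq_sqrt (by nlinarith [hρ.1, hρ.2])
  rw [charFun_apply, integral_map (by fun_prop) (by fun_prop)]
  have hexp : ∀ z : ℝ × ℝ, Complex.exp ((inner ℝ (correlatedPair ρ z) t : ℝ) * Complex.I) =
      Complex.exp ((t.re + ρ * t.im : ℝ) * z.1 * Complex.I) *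
        Complex.exp ((√(1 - ρ ^ 2) * t.im : ℝ) * z.2 * Complex.I) := by
    intro z
    rw [← Complex.exp_add, Complex.inner]
    congr 1
    simp only [Complex.mul_re, Complex.conj_re, Complex.conj_im, correlatedPair_re,
      correlatedPair_im]
    push_cast
    ring
  simp_rw [hexp]
  rw [integral_prod_mul (fun u : ℝ => Complex.exp ((t.re + ρ * t.im : ℝ) * u * Complex.I))
    (fun v : ℝ => Complex.exp ((√(1 - ρ ^ 2) * t.im : ℝ) * v * Complex.I)),
    ← charFun_apply_real, ← charFun_apply_real, charFun_gaussianReal, charFun_gaussianReal,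
    ← Complex.exp_add]
  congr 1
  have hsq' : ((√(1 - ρ ^ 2) : ℝ) : ℂ) ^ 2 = 1 - (ρ : ℂ) ^ 2 := by exact_mod_cast hsq
  push_cast
  simp only [mul_zero, zero_mul, mul_pow, hsq']
  ring

variable {Ω : Type*} [MeasurableSpace Ω] {P : Measure Ω} [IsProbabilityMeasure P]

/-- The central limit theorem for pairs of standardized variables with correlation `ρ`. -/
theorem tendstoInDistribution_pair {X Y : ℕ → Ω → ℝ} {ρ : ℝ} (hρ : ρ ∈ Set.Icc (-1) 1)
    (hindep : iIndepFun (fun v ω => (X v ω, Y v ω)) P)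
    (hident : ∀ v, IdentDistrib (fun ω => (X v ω, Y v ω)) (fun ω => (X 0 ω, Y 0 ω)) P P)
    (hX : MemLp (X 0) 2 P) (hY : MemLp (Y 0) 2 P) (hX0 : P[X 0] = 0) (hY0 : P[Y 0] = 0)
    (hXX : P[X 0 ^ 2] = 1) (hYY : P[Y 0 ^ 2] = 1) (hXY : P[X 0 * Y 0] = ρ) :
    TendstoInDistribution
      (fun (n : ℕ) ω => ((√n)⁻¹ * ∑ v ∈ Finset.range n, X v ω : ℝ) +
        ((√n)⁻¹ * ∑ v ∈ Finset.range n, Y v ω : ℝ) * Complex.I)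
      atTop (correlatedPair ρ) (fun _ => P) stdGaussianPlane where
  forall_aemeasurable n := by
    have hXm v : AEMeasurable (X v) P := measurable_fst.comp_aemeasurable (hident v).aemeasurable_fst
    have hYm v : AEMeasurable (Y v) P := measurable_snd.comp_aemeasurable (hident v).aemeasurable_fst
    fun_prop
  tendsto := by
    have hXm v : AEMeasurable (X v) P := measurable_fst.comp_aemeasurable (hident v).aemeasurable_fst
    have hYm v : AEMeasurable (Y v) P := measurable_snd.comp_aemeasurable (hident v).aemeasurable_fst
    refine ProbabilityMeasure.tendsto_iff_tendsto_charFun.2 fun t => ?_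
    -- Cramér–Wold: the characteristic function of the pair at `t` is that of the projection `L` at
    -- `1`, so the one-dimensional theorem suffices.
    let L : ℝ × ℝ → ℝ := fun z => t.re * z.1 + t.im * z.2
    have hL : Measurable L := by fun_prop
    let W : ℕ → Ω → ℝ := fun v ω => L (X v ω, Y v ω)
    have hW0 : P[W 0] = 0 := by
      simp only [W, L]
      rw [integral_add ((hX.integrable one_le_two).const_mul _)
        ((hY.integrable one_le_two).const_mul _), integral_const_mul, integral_const_mul]
      simp [hX0, hY0]
    have hWmem : MemLp (W 0) 2 P := (hX.const_mul t.re).add (hY.const_mul t.im)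
    have hWvar : Var[W 0; P] = t.re ^ 2 + 2 * ρ * t.re * t.im + t.im ^ 2 := by
      rw [variance_of_integral_eq_zero hWmem.aestronglyMeasurable.aemeasurable hW0]
      have hsq : ∀ ω, W 0 ω ^ 2 = t.re ^ 2 * (X 0 ^ 2) ω +
          2 * t.re * t.im * (X 0 * Y 0) ω + t.im ^ 2 * (Y 0 ^ 2) ω := by
        intro ω
        simp only [W, L, Pi.pow_apply, Pi.mul_apply]
        ring
      have hi1 : Integrable (X 0 ^ 2) P := hX.integrable_sq
      have hi2 : Integrable (Y 0 ^ 2) P := hY.integrable_sq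
      have hi3 : Integrable (X 0 * Y 0) P := hX.integrable_mul hY
      have hi4 : Integrable (fun ω => t.re ^ 2 * (X 0 ^ 2) ω +
          2 * t.re * t.im * (X 0 * Y 0) ω) P := (hi1.const_mul _).add (hi3.const_mul _)
      simp_rw [hsq]
      rw [integral_add hi4 (hi2.const_mul _),
        integral_add (hi1.const_mul _) (hi3.const_mul _), integral_const_mul, integral_const_mul,
        integral_const_mul, hXX, hYY, hXY]
      ring
    have hclt := tendstoInDistribution_inv_sqrt_mul_sum_sub (X := W) (P := P)
      (Y := id) (P' := gaussianReal 0 Var[W 0; P].toNNReal) HasLaw.id hWmem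
      (hindep.comp (fun _ => L) fun _ => hL) (fun v => (hident v).comp hL)
    have h1 := ProbabilityMeasure.tendsto_iff_tendsto_charFun.1 hclt.tendsto 1
    simp only [ProbabilityMeasure.coe_mk, Measure.map_id, charFun_gaussianReal, hW0, mul_zero,
      sub_zero] at h1
    simp only [ProbabilityMeasure.coe_mk]
    rw [charFun_map_correlatedPair hρ]
    convert h1 using 2
    · rename_i n
      rw [charFun_apply, charFun_apply, integral_map (by fun_prop) (by fun_prop),
        integral_map ?_ (by fun_prop)]
      · congr 1 with ω
        congr 2
        generalize (√(n : ℝ))⁻¹ = c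
        simp only [Complex.inner, W, L, Finset.sum_add_distrib, ← Finset.mul_sum]
        simp
        ring_nf
      · simp only [W, L]
        fun_prop
    · rw [hWvar]
      have : 0 ≤ t.re ^ 2 + 2 * ρ * t.re * t.im + t.im ^ 2 := by
        rw [← hWvar]; exact variance_nonneg _ _
      simp only [Real.coe_toNNReal _ this]
      push_cast
      ring_nf

/-- The limit of the probability that two centered random walks with correlated steps are both
positive. -/
theorem tendsto_measureReal_sum_pos_and_sum_pos {X Y : ℕ → Ω → ℝ} {ρ : ℝ}
    (hρ : ρ ∈ Set.Icc (-1) 1)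
    (hindep : iIndepFun (fun v ω => (X v ω, Y v ω)) P)
    (hident : ∀ v, IdentDistrib (fun ω => (X v ω, Y v ω)) (fun ω => (X 0 ω, Y 0 ω)) P P)
    (hX : MemLp (X 0) 2 P) (hY : MemLp (Y 0) 2 P) (hX0 : P[X 0] = 0) (hY0 : P[Y 0] = 0)
    (hXX : P[X 0 ^ 2] = 1) (hYY : P[Y 0 ^ 2] = 1) (hXY : P[X 0 * Y 0] = ρ) :
    Tendsto (fun n : ℕ => P.real {ω | 0 < ∑ v ∈ Finset.range n, X v ω ∧
        0 < ∑ v ∈ Finset.range n, Y v ω}) atTop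
      (𝓝 (1 / 4 + 1 / (2 * Real.pi) * Real.arcsin ρ)) := by
  have hclt := tendstoInDistribution_pair hρ hindep hident hX hY hX0 hY0 hXX hYY hXY
  have hmeas : MeasurableSet {z : ℂ | 0 < z.re ∧ 0 < z.im} :=
    (measurableSet_lt measurable_const Complex.measurable_re).inter
      (measurableSet_lt measurable_const Complex.measurable_im)
  -- The boundary of the quadrant lies on the axes, which are null for the limit law, so weak
  -- convergence gives convergence of this probability.
  have hfrontier : frontier {z : ℂ | 0 < z.re ∧ 0 < z.im} ⊆ {z | z.re = 0} ∪ {z | z.im = 0} := by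
    refine (frontier_inter_subset {z : ℂ | 0 < z.re} {z : ℂ | 0 < z.im}).trans ?_
    rw [Complex.frontier_setOfPred_lt_re, Complex.frontier_setOfPred_lt_im]
    exact Set.union_subset_union Set.inter_subset_left Set.inter_subset_right
  have hnull : (stdGaussianPlane.map (correlatedPair ρ))
      (frontier {z : ℂ | 0 < z.re ∧ 0 < z.im}) = 0 := by
    refine measure_mono_null hfrontier (measure_union_null ?_ ?_)
    · rw [Measure.map_apply (by fun_prop)
        (measurableSet_eq_fun Complex.measurable_re measurable_const)]
      simpa using stdGaussianPlane_fst_eq_zero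
    · rw [Measure.map_apply (by fun_prop)
        (measurableSet_eq_fun Complex.measurable_im measurable_const)]
      have hne : ρ ≠ 0 ∨ √(1 - ρ ^ 2) ≠ 0 := by
        by_cases h : ρ = 0 <;> simp [h]
      simpa using stdGaussianPlane_linear_eq_zero hne
  have hlim := ProbabilityMeasure.tendsto_measure_of_null_frontier_of_tendsto' hclt.tendsto hnull
  simp only [ProbabilityMeasure.coe_mk] at hlim
  have := Measure.isProbabilityMeasure_map (μ := stdGaussianPlane)
    (measurable_correlatedPair ρ).aemeasurable
  have hreal := (ENNReal.tendsto_toReal (measure_ne_top _ _)).comp hlim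
  rw [Measure.map_apply (by fun_prop) hmeas] at hreal
  have hval := stdGaussianPlane_real_quadrant hρ
  rw [measureReal_def] at hval
  simp only [Set.preimage_ofPred_eq, correlatedPair_re, correlatedPair_im, hval] at hreal
  refine (tendsto_congr' ?_).1 hreal
  -- For `n > 0` the scaling is positive and preserves signs; at `n = 0` it is `0`.
  filter_upwards [eventually_gt_atTop 0] with n hn
  have hpos : 0 < (√(n : ℝ))⁻¹ := by positivity
  rw [Function.comp_apply, Measure.map_apply_of_aemeasurable (hclt.forall_aemeasurable n) hmeas,
    measureReal_def]
  congr 2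
  ext ω
  simp [-Complex.ofReal_sum, -Complex.ofReal_mul, -Complex.ofReal_inv, hpos,
    mul_pos_iff_of_pos_left]

/-! ### Algebra of comparison signs and the table -/

lemma a_swap {m : ℕ} (r : Ranking m) {i j : Fin m} (h : i ≠ j) : a r j i = -a r i j := by
  have hne : r.position i ≠ r.position j := r.position.injective.ne h
  rcases lt_or_gt_of_ne hne with h' | h' <;>
    simp [a, Ranking.Prefers, h', h'.not_gt]

lemma a_sq {m : ℕ} (r : Ranking m) (i j : Fin m) : (a r i j : ℝ) ^ 2 = 1 := by
  unfold a
  split_ifs <;> simp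

/-- This makes the mean of `a₂` the mixed second moment of the two steps, which is the covariance
when the drifts vanish. -/
lemma a_mul_a {m : ℕ} (r : Ranking m) {i j l : Fin m} (hj : j ≠ i) (hl : l ≠ i) :
    a r i j * a r i l = a₂ r i j l := by
  have hnej : r.position j ≠ r.position i := r.position.injective.ne hj
  have hnel : r.position l ≠ r.position i := r.position.injective.ne hl
  rcases lt_or_gt_of_ne hnej with h | h <;> rcases lt_or_gt_of_ne hnel with h' | h' <;>
    simp [a, a₂, Ranking.Prefers, h, h', h.not_gt, h'.not_gt]

lemma abs_a₂ {m : ℕ} (r : Ranking m) (i j l : Fin m) : |(a₂ r i j l : ℝ)| = 1 := by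
  unfold a₂
  split_ifs <;> simp

lemma lam_swap {m : ℕ} (p : Ranking m → ℝ) {i j : Fin m} (h : i ≠ j) :
    lam p j i = -lam p i j := by
  simp [lam, a_swap _ h]

lemma R_of_lam_eq_zero {m : ℕ} {p : Ranking m → ℝ} {i j l : Fin m} (hj : lam p i j = 0)
    (hl : lam p i l = 0) : R p i j l = ∑ r, (a₂ r i j l : ℝ) * p r := by
  simp [R, hj, hl]

lemma beats_iff {m : ℕ} (V : ℕ → Ranking m) (n : ℕ) (i j : Fin m) :
    Beats V n i j ↔ 0 < ∑ v ∈ Finset.range n, (a (V v) i j : ℝ) := by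
  rw [Beats, ← Int.cast_sum, Int.cast_pos]
  rfl

lemma Beats.asymm {m : ℕ} {V : ℕ → Ranking m} {n : ℕ} {i j : Fin m} (hij : i ≠ j)
    (h : Beats V n i j) : ¬Beats V n j i := by
  simp only [Beats, a_swap _ hij, Finset.sum_neg_distrib] at h ⊢
  omega

/-- The limiting probability that a candidate beats both opponents, from the signs of the mean
margins and the correlation `x` of the two margins. -/
noncomputable def winLimit (s t : SignType) (x : ℝ) : ℝ :=
  match s, t with
  | .neg, _ => 0
  | _, .neg => 0
  | .pos, .pos => 1
  | .pos, .zero => 1 / 2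
  | .zero, .pos => 1 / 2
  | .zero, .zero => 1 / 4 + 1 / (2 * Real.pi) * Real.arcsin x

set_option linter.unusedSimpArgs false in
-- Each candidate sees the drifts from its own side, hence the sign changes for the second and
-- third.
lemma table_eq_add (s₁₂ s₁₃ s₂₃ : SignType) (R₁ R₂ R₃ : ℝ) :
    table s₁₂ s₁₃ s₂₃ R₁ R₂ R₃ =
      winLimit s₁₂ s₁₃ R₁ + winLimit (-s₁₂) s₂₃ R₂ + winLimit (-s₁₃) (-s₂₃) R₃ := by
  have hz : -SignType.zero = SignType.zero := rfl
  have hp : -SignType.pos = SignType.neg := rfl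
  have hn : -SignType.neg = SignType.pos := rfl
  cases s₁₂ <;> cases s₁₃ <;> cases s₂₃ <;> simp only [table, winLimit, hz, hp, hn] <;> ring

/-! ### Majority comparisons among random voters -/

instance (m : ℕ) : DiscreteMeasurableSpace (Ranking m) := ⟨fun _ => trivial⟩

/-- The indicators of the symmetric differences tend to `0` almost everywhere, so their
probabilities do too. This transfers almost sure decisions to limits of probabilities. -/
lemma tendsto_measureReal_of_ae_eventually_iff {Q Q' : ℕ → Ω → Prop} {c : ℝ}
    (hQ : ∀ n, MeasurableSet {ω | Q n ω}) (hQ' : ∀ n, MeasurableSet {ω | Q' n ω})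
    (hiff : ∀ᵐ ω ∂P, ∀ᶠ n in atTop, Q n ω ↔ Q' n ω)
    (hlim : Tendsto (fun n => P.real {ω | Q' n ω}) atTop (𝓝 c)) :
    Tendsto (fun n => P.real {ω | Q n ω}) atTop (𝓝 c) := by
  have hsymm : Tendsto (fun n => P.real (symmDiff {ω | Q n ω} {ω | Q' n ω})) atTop (𝓝 0) := by
    have h := tendsto_measure_of_ae_tendsto_indicator_of_isFiniteMeasure atTop (μ := P)
      (A := ∅) (As := fun n => symmDiff {ω | Q n ω} {ω | Q' n ω}) MeasurableSet.empty
      (fun n => (hQ n).symmDiff (hQ' n)) (by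
        filter_upwards [hiff] with ω hω
        filter_upwards [hω] with n hn
        simp [Set.mem_symmDiff, hn])
    simpa [measureReal_def, Function.comp_def] using (ENNReal.tendsto_toReal (measure_ne_top _ _)).comp h
  have hdiff : Tendsto (fun n => P.real {ω | Q n ω} - P.real {ω | Q' n ω}) atTop (𝓝 0) :=
    squeeze_zero_norm (fun n => abs_measureReal_sub_le_measureReal_symmDiff
      (hQ n).nullMeasurableSet (hQ' n).nullMeasurableSet) hsymm
  simpa using hdiff.add hlim

section Voters

variable {m : ℕ} {p : Ranking m → ℝ} {V : ℕ → Ω → Ranking m}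

lemma identDistrib_voter (hmeas : ∀ v, Measurable (V v))
    (hlaw : ∀ v r, P.real {ω | V v ω = r} = p r) (v : ℕ) : IdentDistrib (V v) (V 0) P P where
  aemeasurable_fst := (hmeas v).aemeasurable
  aemeasurable_snd := (hmeas 0).aemeasurable
  map_eq := by
    refine Measure.ext_of_singleton fun r => ?_
    rw [Measure.map_apply (hmeas v) (.singleton r), Measure.map_apply (hmeas 0) (.singleton r),
      ← measureReal_eq_measureReal_iff]
    exact (hlaw v r).trans (hlaw 0 r).symm

lemma integral_voter (hmeas : ∀ v, Measurable (V v))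
    (hlaw : ∀ v r, P.real {ω | V v ω = r} = p r) (v : ℕ) (f : Ranking m → ℝ) :
    ∫ ω, f (V v ω) ∂P = ∑ r, f r * p r := by
  have := Measure.isProbabilityMeasure_map (μ := P) (hmeas v).aemeasurable
  rw [← integral_map (hmeas v).aemeasurable Measurable.of_discrete.aestronglyMeasurable,
    integral_fintype .of_finite]
  refine Finset.sum_congr rfl fun r _ => ?_
  rw [map_measureReal_apply (hmeas v) (.singleton r), smul_eq_mul, mul_comm, ← hlaw v r]
  rfl

lemma memLp_voter (hmeas : ∀ v, Measurable (V v)) (v : ℕ) (f : Ranking m → ℝ) (q : ENNReal) :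
    MemLp (fun ω => f (V v ω)) q P := by
  have := Measure.isProbabilityMeasure_map (μ := P) (hmeas v).aemeasurable
  exact (MemLp.of_discrete (f := f) (μ := P.map (V v))).comp_measurePreserving
    ⟨hmeas v, rfl⟩

lemma measurableSet_beats (hmeas : ∀ v, Measurable (V v)) (n : ℕ) (i j : Fin m) :
    MeasurableSet {ω | Beats (fun v => V v ω) n i j} := by
  have h (v : ℕ) : Measurable fun ω => a (V v ω) i j :=
    (Measurable.of_discrete (f := fun r : Ranking m => a r i j)).comp (hmeas v)
  exact measurableSet_le measurable_const (Finset.measurable_fun_sum _ fun v _ => h v)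

lemma ae_tendsto_margin (hmeas : ∀ v, Measurable (V v)) (hindep : iIndepFun V P)
    (hlaw : ∀ v r, P.real {ω | V v ω = r} = p r) (i j : Fin m) :
    ∀ᵐ ω ∂P, Tendsto (fun n : ℕ => (∑ v ∈ Finset.range n, (a (V v ω) i j : ℝ)) / n) atTop
      (𝓝 (lam p i j)) := by
  have h := strong_law_ae_real (μ := P) (fun v ω => (a (V v ω) i j : ℝ))
    (memLp_one_iff_integrable.1 (memLp_voter hmeas 0 (fun r => (a r i j : ℝ)) 1))
    (fun v w hvw => (hindep.indepFun hvw).comp (φ := fun r => (a r i j : ℝ))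
      (ψ := fun r => (a r i j : ℝ)) .of_discrete .of_discrete)
    (fun v => (identDistrib_voter hmeas hlaw v).comp (u := fun r => (a r i j : ℝ)) .of_discrete)
  rwa [integral_voter hmeas hlaw 0 (fun r => (a r i j : ℝ))] at h

lemma ae_eventually_beats (hmeas : ∀ v, Measurable (V v)) (hindep : iIndepFun V P)
    (hlaw : ∀ v r, P.real {ω | V v ω = r} = p r) {i j : Fin m} (hpos : 0 < lam p i j) :
    ∀ᵐ ω ∂P, ∀ᶠ n in atTop, Beats (fun v => V v ω) n i j := by
  filter_upwards [ae_tendsto_margin hmeas hindep hlaw i j] with ω hω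
  filter_upwards [hω.eventually_const_lt hpos, eventually_gt_atTop 0] with n hn hn0
  exact (beats_iff _ _ _ _).2 ((div_pos_iff_of_pos_right (by exact_mod_cast hn0)).1 hn)

lemma ae_eventually_not_beats (hmeas : ∀ v, Measurable (V v)) (hindep : iIndepFun V P)
    (hlaw : ∀ v r, P.real {ω | V v ω = r} = p r) {i j : Fin m} (hneg : lam p i j < 0) :
    ∀ᵐ ω ∂P, ∀ᶠ n in atTop, ¬Beats (fun v => V v ω) n i j := by
  filter_upwards [ae_tendsto_margin hmeas hindep hlaw i j] with ω hω
  filter_upwards [hω.eventually_lt_const hneg] with n hn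
  rw [beats_iff, not_lt]
  by_contra! h
  exact hn.not_ge (by positivity)

lemma sum_law (hmeas : ∀ v, Measurable (V v)) (hlaw : ∀ v r, P.real {ω | V v ω = r} = p r) :
    ∑ r, p r = 1 := by
  have h := integral_voter hmeas hlaw 0 (fun _ => 1)
  simpa using h.symm

/-- Steps `±1` have second moment 1 without normalization. The choice `j = l` is allowed and is used
for a single comparison. -/
lemma tendsto_beats_and_beats_of_lam_eq_zero (hmeas : ∀ v, Measurable (V v))
    (hindep : iIndepFun V P) (hlaw : ∀ v r, P.real {ω | V v ω = r} = p r) {i j l : Fin m}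
    (hj : j ≠ i) (hl : l ≠ i) (hj0 : lam p i j = 0) (hl0 : lam p i l = 0) :
    Tendsto (fun n : ℕ => P.real {ω | Beats (fun v => V v ω) n i j ∧
        Beats (fun v => V v ω) n i l}) atTop
      (𝓝 (1 / 4 + 1 / (2 * Real.pi) * Real.arcsin (∑ r, (a₂ r i j l : ℝ) * p r))) := by
  have hp : ∀ r, 0 ≤ p r := fun r => by rw [← hlaw 0 r]; exact measureReal_nonneg
  -- An average of signs lies in `[-1, 1]`.
  have hρ : (∑ r, (a₂ r i j l : ℝ) * p r) ∈ Set.Icc (-1) 1 := by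
    rw [Set.mem_Icc, ← abs_le]
    refine (Finset.abs_sum_le_sum_abs _ _).trans (le_of_eq ?_)
    simp_rw [abs_mul, abs_a₂, one_mul, abs_of_nonneg (hp _)]
    exact sum_law hmeas hlaw
  have hsq (k : Fin m) : P[(fun ω => (a (V 0 ω) i k : ℝ)) ^ 2] = 1 := by
    simp [a_sq]
  have h := tendsto_measureReal_sum_pos_and_sum_pos (P := P)
    (X := fun v ω => (a (V v ω) i j : ℝ)) (Y := fun v ω => (a (V v ω) i l : ℝ)) hρ
    (hindep.comp (fun _ r => ((a r i j : ℝ), (a r i l : ℝ))) fun _ => .of_discrete)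
    (fun v => (identDistrib_voter hmeas hlaw v).comp
      (u := fun r => ((a r i j : ℝ), (a r i l : ℝ))) .of_discrete)
    (memLp_voter hmeas 0 (fun r => (a r i j : ℝ)) 2)
    (memLp_voter hmeas 0 (fun r => (a r i l : ℝ)) 2)
    ((integral_voter hmeas hlaw 0 (fun r => (a r i j : ℝ))).trans hj0)
    ((integral_voter hmeas hlaw 0 (fun r => (a r i l : ℝ))).trans hl0)
    (hsq j) (hsq l)
    ((integral_voter hmeas hlaw 0 (fun r => (a r i j : ℝ) * (a r i l : ℝ))).trans
      (Finset.sum_congr rfl fun r _ => by rw [← a_mul_a r hj hl]; push_cast; rfl))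
  simpa only [beats_iff] using h

lemma a₂_self {i j : Fin m} (hj : j ≠ i) (r : Ranking m) : a₂ r i j j = 1 := by
  have h := a_sq r i j
  rw [← a_mul_a r hj hj, ← sq]
  exact_mod_cast h

/-- Repeating the opponent gives correlation 1, and `arcsin 1 = π / 2`. -/
lemma tendsto_beats_of_lam_eq_zero (hmeas : ∀ v, Measurable (V v))
    (hindep : iIndepFun V P) (hlaw : ∀ v r, P.real {ω | V v ω = r} = p r) {i j : Fin m}
    (hj : j ≠ i) (hj0 : lam p i j = 0) :
    Tendsto (fun n : ℕ => P.real {ω | Beats (fun v => V v ω) n i j}) atTop (𝓝 (1 / 2)) := by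
  have h := tendsto_beats_and_beats_of_lam_eq_zero hmeas hindep hlaw hj hj hj0 hj0
  have hval : 1 / 4 + 1 / (2 * Real.pi) * (Real.pi / 2) = 1 / 2 := by
    field_simp
    norm_num
  simpa only [and_self, a₂_self hj, Int.cast_one, one_mul, sum_law hmeas hlaw, Real.arcsin_one,
    hval] using h

/-- The limiting probability that a candidate beats two given opponents. -/
theorem tendsto_beats_and_beats (hmeas : ∀ v, Measurable (V v))
    (hindep : iIndepFun V P) (hlaw : ∀ v r, P.real {ω | V v ω = r} = p r) {i j l : Fin m}
    (hj : j ≠ i) (hl : l ≠ i) :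
    Tendsto (fun n : ℕ => P.real {ω | Beats (fun v => V v ω) n i j ∧
        Beats (fun v => V v ω) n i l}) atTop
      (𝓝 (winLimit (SignType.sign (lam p i j)) (SignType.sign (lam p i l)) (R p i j l))) := by
  have hB (k : Fin m) n := measurableSet_beats hmeas n i k
  have hBB n : MeasurableSet {ω | Beats (fun v => V v ω) n i j ∧ Beats (fun v => V v ω) n i l} :=
    (hB j n).inter (hB l n)
  rcases lt_trichotomy (lam p i j) 0 with hsj | hsj | hsj
  · have hlim : winLimit (SignType.sign (lam p i j)) (SignType.sign (lam p i l)) (R p i j l) =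
        0 := by
      rw [sign_neg hsj]; rfl
    rw [hlim]
    refine tendsto_measureReal_of_ae_eventually_iff (Q' := fun _ _ => False) hBB (by simp) ?_
      (by simp)
    filter_upwards [ae_eventually_not_beats hmeas hindep hlaw hsj] with ω hω
    filter_upwards [hω] with n hn
    simp [hn]
  all_goals rcases lt_trichotomy (lam p i l) 0 with hsl | hsl | hsl
  · rw [hsj, sign_zero, sign_neg hsl]
    refine tendsto_measureReal_of_ae_eventually_iff (Q' := fun _ _ => False) hBB (by simp) ?_
      (by simp [show winLimit 0 (-1) (R p i j l) = 0 from rfl])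
    filter_upwards [ae_eventually_not_beats hmeas hindep hlaw hsl] with ω hω
    filter_upwards [hω] with n hn
    simp [hn]
  · rw [hsj, hsl, R_of_lam_eq_zero hsj hsl, sign_zero]
    exact tendsto_beats_and_beats_of_lam_eq_zero hmeas hindep hlaw hj hl hsj hsl
  · rw [hsj, sign_zero, sign_pos hsl]
    -- The comparison with `l` is eventually won, so only the one with `j` remains.
    refine tendsto_measureReal_of_ae_eventually_iff hBB (hB j) ?_
      (tendsto_beats_of_lam_eq_zero hmeas hindep hlaw hj hsj)
    filter_upwards [ae_eventually_beats hmeas hindep hlaw hsl] with ω hω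
    filter_upwards [hω] with n hn
    simp [hn]
  · rw [sign_pos hsj, sign_neg hsl]
    refine tendsto_measureReal_of_ae_eventually_iff (Q' := fun _ _ => False) hBB (by simp) ?_
      (by simp [show winLimit 1 (-1) (R p i j l) = 0 from rfl])
    filter_upwards [ae_eventually_not_beats hmeas hindep hlaw hsl] with ω hω
    filter_upwards [hω] with n hn
    simp [hn]
  · rw [hsl, sign_zero, sign_pos hsj]
    refine tendsto_measureReal_of_ae_eventually_iff hBB (hB l) ?_
      (tendsto_beats_of_lam_eq_zero hmeas hindep hlaw hl hsl)
    filter_upwards [ae_eventually_beats hmeas hindep hlaw hsj] with ω hω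
    filter_upwards [hω] with n hn
    simp [hn]
  · rw [sign_pos hsj, sign_pos hsl]
    refine tendsto_measureReal_of_ae_eventually_iff (Q' := fun _ _ => True) hBB (by simp) ?_
      (by simp [show winLimit 1 1 (R p i j l) = 1 from rfl])
    filter_upwards [ae_eventually_beats hmeas hindep hlaw hsj,
      ae_eventually_beats hmeas hindep hlaw hsl] with ω hω hω'
    filter_upwards [hω, hω'] with n hn hn'
    simp [hn, hn']

end Voters

/-! ### Summing over the three candidates -/

/-- Two winners would have to beat each other, so the three events are disjoint. -/
lemma measureReal_exists_isWinner {V : ℕ → Ω → Ranking 3} (hmeas : ∀ v, Measurable (V v)) (n : ℕ) :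
    P.real {ω | ∃ i, IsWinner (fun v => V v ω) n i} =
      P.real {ω | Beats (fun v => V v ω) n 0 1 ∧ Beats (fun v => V v ω) n 0 2} +
      P.real {ω | Beats (fun v => V v ω) n 1 0 ∧ Beats (fun v => V v ω) n 1 2} +
      P.real {ω | Beats (fun v => V v ω) n 2 0 ∧ Beats (fun v => V v ω) n 2 1} := by
  have hB (i j l : Fin 3) :
      MeasurableSet {ω | Beats (fun v => V v ω) n i j ∧ Beats (fun v => V v ω) n i l} :=
    (measurableSet_beats hmeas n i j).inter (measurableSet_beats hmeas n i l)
  rw [← measureReal_union _ (hB 1 0 2), ← measureReal_union _ (hB 2 0 1)]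
  · congr 1
    ext ω
    simp [IsWinner, Fin.exists_fin_succ, Fin.forall_fin_succ, or_assoc]
  · rw [Set.disjoint_left]
    rintro ω (h | h) h'
    · exact h.2.asymm (by decide) h'.1
    · exact h.2.asymm (by decide) h'.2
  · rw [Set.disjoint_left]
    rintro ω h h'
    exact h.1.asymm (by decide) h'.1

end Condorcet

theorem mainTheorem6 {Ω : Type*} [MeasurableSpace Ω] (P : Measure Ω) [IsProbabilityMeasure P]
    (p : Condorcet.Ranking 3 → ℝ)
    (V : ℕ → Ω → Condorcet.Ranking 3)
    (hmeas : ∀ v, Measurable (V v))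
    (hindep : iIndepFun V P)
    (hlaw : ∀ v r, P.real {ω | V v ω = r} = p r) :
    Tendsto (fun n : ℕ => P.real {ω | ∃ i, Condorcet.IsWinner (fun v => V v ω) n i}) atTop
      (𝓝 (Condorcet.table
        (SignType.sign (Condorcet.lam p 0 1))
        (SignType.sign (Condorcet.lam p 0 2))
        (SignType.sign (Condorcet.lam p 1 2))
        (Condorcet.R p 0 1 2)
        (Condorcet.R p 1 0 2)
        (Condorcet.R p 2 0 1))) := by
  have h := ((Condorcet.tendsto_beats_and_beats hmeas hindep hlaw (i := 0) (j := 1) (l := 2)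
      (by decide) (by decide)).add
    (Condorcet.tendsto_beats_and_beats hmeas hindep hlaw (i := 1) (j := 0) (l := 2)
      (by decide) (by decide))).add
    (Condorcet.tendsto_beats_and_beats hmeas hindep hlaw (i := 2) (j := 0) (l := 1)
      (by decide) (by decide))
  rw [Condorcet.lam_swap p (show (0 : Fin 3) ≠ 1 by decide),
    Condorcet.lam_swap p (show (0 : Fin 3) ≠ 2 by decide),
    Condorcet.lam_swap p (show (1 : Fin 3) ≠ 2 by decide), Left.sign_neg, Left.sign_neg,
    Left.sign_neg, ← Condorcet.table_eq_add] at h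
  simpa only [Condorcet.measureReal_exists_isWinner hmeas] using h
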